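/- Let $\mathcal{G}$ be a finite, simple, connected undirected graph with vertex set $V$, $|V|\ge 2$. Its symmetric edge polytope is $$P_{\mathcal{G}}=\mathrm{conv}\{\mathbf 1_u-\mathbf 1_w,\ \mathbf 1_w-\mathbf 1_u \mid uw\in E(\mathcal{G})\}\subset\mathbb{R}^V .$$ For a lattice polytope $P\subset\mathbb{R}^V$ of dimension $d$, its $h^*$-vector is the unique sequence $(h^*_0,\dots,h^*_d)$ of rational numbers (with $h^*_i:=0$ for $i>d$) such that $|tP\cap\mathbb{Z}^V|=\sum_{k=0}^d h^*_k\binom{t+d-k}{d}$ for all $t\in\mathbb{N}$. For an oriented spanning tree $T$ of $\mathcal{G}$ (a spanning tree with a choice of orientation of each of its edges), let $$\mathcal{Q}_T=\mathrm{conv}\{\mathbf 1_h-\mathbf 1_t\mid \overrightarrow{th}\in T\}.$$ A set $\mathcal{T}$ of oriented spanning trees of $\mathcal{G}$ is called a dissecting tree set for $\mathcal{G}$ if the simplices $\mathcal{Q}_T$, $T\in\mathcal{T}$, have pairwise disjoint relative interiors and their union is the (relative) boundary of $P_{\mathcal{G}}$. For a vertex $v$, an edge $e\in T$ points away from $v$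 in $T$ if $v$ is in the component of $T-e$ that contains the tail of $e$. Theorem. Let $\mathcal{T}$ be any dissecting tree set for $\mathcal{G}$ and let $v$ be any vertex of $\mathcal{G}$. Then the $h^*$-vector $h^*_{\mathcal{G}}$ of $P_{\mathcal{G}}$ satisfies, for all $i\ge 0$, $$(h^*_{\mathcal{G}})_i=|\{T\in\mathcal{T}\mid T\text{ has exactly } i \text{ edges pointing away from } v\}|.$$ -/

import Mathlib

open scoped Pointwise

noncomputable section

namespace SymEdge

/-! ### Ehrhart theory -/

/-- The point count of the `t`-th dilate of `P`: the number of points of `ℤ^V` lying in `t • P`. -/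
def ehrhart {V : Type*} (P : Set (V → ℝ)) (t : ℕ) : ℕ :=
  {z : V → ℤ | (fun w => (z w : ℝ)) ∈ (t : ℝ) • P}.ncard

/-- The dimension of a polytope, i.e. of its affine hull. -/
def polytopeDim {V : Type*} (P : Set (V → ℝ)) : ℕ :=
  Module.finrank ℝ (vectorSpan ℝ P)

/-- `a` is the `h^*`-vector of `P`: with `d = dim P`, the counting function of `P` is
`∑_{k=0}^d a_k * binom (t + d - k, d)`, and `a` has no further nonzero entries. (For `k ≤ d` and
`t` natural the subtraction does not truncate, and a polynomial is determined by its values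
on `ℕ`, so this is the identity of polynomials in `t`.) -/
def IsHStarVector {V : Type*} (P : Set (V → ℝ)) (a : ℕ → ℚ) : Prop :=
  (∀ t : ℕ, (ehrhart P t : ℚ) =
    ∑ k ∈ Finset.range (polytopeDim P + 1),
      a k * ((t + polytopeDim P - k).choose (polytopeDim P) : ℚ)) ∧
  ∀ k : ℕ, polytopeDim P < k → a k = 0

/-- The `h^*`-vector is unique. -/
theorem IsHStarVector.unique {V : Type*} {P : Set (V → ℝ)} {a b : ℕ → ℚ}
    (ha : IsHStarVector P a) (hb : IsHStarVector P b) : a = b := by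
  funext i
  induction i using Nat.strong_induction_on with
  | _ i ih =>
    rcases lt_or_ge (polytopeDim P) i with hi | hi
    · rw [ha.2 i hi, hb.2 i hi]
    · have h := (ha.1 i).symm.trans (hb.1 i)
      have hmem : i ∈ Finset.range (polytopeDim P + 1) := Finset.mem_range.2 (by omega)
      rw [← Finset.add_sum_erase _ _ hmem, ← Finset.add_sum_erase _ _ hmem] at h
      have hrest : ∀ k ∈ (Finset.range (polytopeDim P + 1)).erase i,
          a k * ((i + polytopeDim P - k).choose (polytopeDim P) : ℚ) =
          b k * ((i + polytopeDim P - k).choose (polytopeDim P) : ℚ) := by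
        intro k hk
        rw [Finset.mem_erase, Finset.mem_range] at hk
        rcases lt_or_ge k i with hki | hki
        · rw [ih k hki]
        · have hz : (i + polytopeDim P - k).choose (polytopeDim P) = 0 :=
            Nat.choose_eq_zero_of_lt (by omega)
          simp [hz]
      rw [Finset.sum_congr rfl hrest] at h
      have h' := add_right_cancel h
      have hone : (i + polytopeDim P - i).choose (polytopeDim P) = 1 := by
        rw [Nat.add_sub_cancel_left, Nat.choose_self]
      simpa [hone] using h'

open Classical in
/-- The `h^*`-vector of `P` (zero if `P` has none). -/
def hStarVector {V : Type*} (P : Set (V → ℝ)) : ℕ → ℚ :=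
  if h : ∃ a : ℕ → ℚ, IsHStarVector P a then h.choose else 0

/-! ### Polytopes of graphs -/

/-- The symmetric edge polytope of an undirected graph: the convex hull of the vectors
`1_u - 1_w` over all ordered pairs of adjacent vertices. -/
def symmetricEdgePolytope {V : Type*} [DecidableEq V] (G : SimpleGraph V) : Set (V → ℝ) :=
  convexHull ℝ {x | ∃ u w : V, G.Adj u w ∧ x = Pi.single u 1 - Pi.single w 1}

/-- The root polytope of a directed graph: the convex hull of the vectors
`1_head - 1_tail` over all directed edges; `D.Adj t h` is an edge with tail `t` and head `h`. -/
def rootPolytope {V : Type*} [DecidableEq V] (D : Digraph V) : Set (V → ℝ) :=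
  convexHull ℝ {x | ∃ t h : V, D.Adj t h ∧ x = Pi.single h 1 - Pi.single t 1}

/-! ### Oriented spanning trees and dissections -/

/-- `T` is an oriented spanning tree of `G`: a spanning tree of `G` in which each edge carries
exactly one orientation. -/
structure IsOrientedSpanningTree {V : Type*} (G : SimpleGraph V) (T : Digraph V) : Prop where
  adj_of_adj : ∀ t h : V, T.Adj t h → G.Adj t h
  asymm : ∀ t h : V, T.Adj t h → ¬ T.Adj h t
  isTree : T.toSimpleGraphInclusive.IsTree

/-- `𝒯` is a dissecting tree set for `G`: the polytopes `Q_T`, `T ∈ 𝒯`, have pairwise disjoint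
(relative) interiors and their union is the (relative) boundary of the symmetric edge polytope. -/
structure IsDissectingTreeSet {V : Type*} [Fintype V] [DecidableEq V] (G : SimpleGraph V)
    (𝒯 : Set (Digraph V)) : Prop where
  isOrientedSpanningTree : ∀ T ∈ 𝒯, IsOrientedSpanningTree G T
  interior_disjoint : ∀ T ∈ 𝒯, ∀ T' ∈ 𝒯, T ≠ T' →
    Disjoint (intrinsicInterior ℝ (rootPolytope T)) (intrinsicInterior ℝ (rootPolytope T'))
  cover : ⋃ T ∈ 𝒯, rootPolytope T = intrinsicFrontier ℝ (symmetricEdgePolytope G)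

/-- The edge `e` (with tail `e.1` and head `e.2`) of the oriented tree `T` points away from `v`:
`v` lies in the component of `T - e` that contains the tail of `e`. -/
def PointsAwayFrom {V : Type*} (T : Digraph V) (v : V) (e : V × V) : Prop :=
  T.Adj e.1 e.2 ∧ (T.toSimpleGraphInclusive.deleteEdges {s(e.1, e.2)}).Reachable e.1 v

/-- The number of edges of `T` that point away from `v`. -/
def numPointingAway {V : Type*} (T : Digraph V) (v : V) : ℕ :=
  {e : V × V | PointsAwayFrom T v e}.ncard

end SymEdge

end

/-! The edge vectors of a spanning tree `T` form a basis of the zero-sum vectors over ℤ as well as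
over ℝ; the coefficient of `x` at `e` is the sum of `x` over the component of `T - e` containing the
head (`sum_coeff_smul`). So every simplex of the dissection is unimodular.

Since the simplices tile the boundary of `P`, their cones cover the zero-sum space and have disjoint
interiors. On each cone the gauge of `P` is the sum of the coefficients (`gauge_eq_sum_coeff`), so
membership in `t • P` there means coefficient sum at most `t`.

To count each lattice point once, push it slightly along `|V| 1_v - ∑ 1_u`. The coefficient of this
vector at `e` is minus the size of the head side if `e` points away from `v`, and the size of the
tail side otherwise. It is never zero, so the push lands in exactly one open cone. Hence the cones,
with the facets opposite to edges pointing away from `v` removed, partition the space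
(`existsUnique_mem_halfOpenCone`). With `i` facets removed and `d = dim P`, a cone contributes
`binom (t + d - i, d)` points (`ncard_setOf_nonneg_sum_le`). Summing over the trees gives the
defining identity of the `h^*`-vector, which is unique. -/

open scoped Pointwise

noncomputable section

namespace SymEdge

section

/-! ### Coordinates of an oriented spanning tree -/

/-- The directed edges of `T`, as pairs (tail, head). -/
abbrev Arc {V : Type*} (T : Digraph V) : Type _ := {e : V × V // T.Adj e.1 e.2}

instance {V : Type*} [Finite V] (T : Digraph V) : Fintype (Arc T) := Fintype.ofFinite _

/-- The vector `1_head - 1_tail` of a pair `(tail, head)`. -/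
def arcVec (R : Type*) [Ring R] {V : Type*} [DecidableEq V] (e : V × V) : V → R :=
  Pi.single e.2 1 - Pi.single e.1 1

/-- The component of `T - e` that contains the head of `e`. -/
def headSide {V : Type*} (T : Digraph V) (e : V × V) : Set V :=
  {u | (T.toSimpleGraphInclusive.deleteEdges {s(e.1, e.2)}).Reachable e.2 u}

open Classical in
/-- The sum of `x` over the head side of `e`: the coefficient at `e` in the expansion of a
vector with zero sum in the basis given by the edges of the tree. -/
def coeff {R : Type*} [Ring R] {V : Type*} [Fintype V] (T : Digraph V) (e : V × V) :
    (V → R) →ₗ[R] R where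
  toFun x := ∑ u, if u ∈ headSide T e then x u else 0
  map_add' x y := by
    rw [← Finset.sum_add_distrib]
    exact Finset.sum_congr rfl fun u _ => by split_ifs <;> simp
  map_smul' r x := by
    simp [Finset.mul_sum]

theorem sum_arcVec {R : Type*} [Ring R] {V : Type*} [Fintype V] [DecidableEq V] (e : V × V) :
    ∑ u, arcVec R e u = 0 := by
  simp [arcVec, Finset.sum_sub_distrib]

open Classical in
theorem coeff_arcVec {R : Type*} [Ring R] {V : Type*} [Fintype V] [DecidableEq V]
    (T : Digraph V) (e f : V × V) :
    coeff T e (arcVec R f) =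
      (if f.2 ∈ headSide T e then 1 else 0) - (if f.1 ∈ headSide T e then 1 else 0) := by
  have key (w : V) : (∑ u, if u ∈ headSide T e then (Pi.single w 1 : V → R) u else 0) =
      if w ∈ headSide T e then 1 else 0 := by
    rw [Finset.sum_eq_single w]
    · simp
    · intro u _ hu
      simp [hu]
    · simp
  rw [arcVec, map_sub]
  exact congrArg₂ _ (key _) (key _)

theorem coeff_intCast {V : Type*} [Fintype V] (T : Digraph V) (e : V × V) (z : V → ℤ) :
    coeff T e (fun u => (z u : ℝ)) = (coeff T e z : ℤ) := by
  simp only [coeff, LinearMap.coe_mk, AddHom.coe_mk, Int.cast_sum]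
  exact Finset.sum_congr rfl fun u _ => by split_ifs <;> simp

/-- The vectors `1_u - 1_w` of adjacent pairs in a connected graph span the vectors with zero
sum. -/
theorem mem_of_sum_eq_zero {R : Type*} [Ring R] {V : Type*} [Fintype V] [DecidableEq V]
    {S : SimpleGraph V} (hS : S.Connected) {M : Submodule R (V → R)}
    (hM : ∀ u w, S.Adj u w → arcVec R (u, w) ∈ M) {x : V → R} (hx : ∑ u, x u = 0) : x ∈ M := by
  have hpath : ∀ {u w : V}, S.Walk u w → arcVec R (u, w) ∈ M := by
    intro u w p
    induction p with
    | nil => simp [arcVec]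
    | @cons a b c h p ih =>
      have : arcVec R (a, c) = arcVec R (a, b) + arcVec R (b, c) := by simp [arcVec]
      rw [this]
      exact M.add_mem (hM _ _ h) ih
  obtain ⟨w⟩ := hS.nonempty
  -- The contributions at the base vertex `w` cancel because the entries of `x` sum to zero.
  have hx' : x = ∑ u, x u • arcVec R (w, u) := by
    simp only [arcVec, smul_sub, Finset.sum_sub_distrib, ← Finset.sum_smul, hx, zero_smul, sub_zero]
    ext a
    simp [Finset.sum_apply, Pi.single_apply]
  rw [hx']
  exact M.sum_mem fun u _ => M.smul_mem _ (hpath (hS.preconnected w u).some)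

namespace IsOrientedSpanningTree

variable {V : Type*} {G : SimpleGraph V} {T : Digraph V}

theorem ne (hT : IsOrientedSpanningTree G T) {t h : V} (e : T.Adj t h) : t ≠ h :=
  (hT.adj_of_adj t h e).ne

theorem toSimpleGraph_adj (hT : IsOrientedSpanningTree G T) {t h : V} (e : T.Adj t h) :
    T.toSimpleGraphInclusive.Adj t h :=
  (SimpleGraph.fromRel_adj _ _ _).2 ⟨hT.ne e, Or.inl e⟩

theorem adj_or_adj {t h : V} (e : T.toSimpleGraphInclusive.Adj t h) : T.Adj t h ∨ T.Adj h t :=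
  ((SimpleGraph.fromRel_adj _ _ _).1 e).2

/-- Every edge of an acyclic graph is a bridge. -/
theorem tail_notMem (hT : IsOrientedSpanningTree G T) (e : Arc T) : e.1.1 ∉ headSide T e.1 := by
  intro h
  exact SimpleGraph.isAcyclic_iff_forall_adj_isBridge.1 hT.isTree.isAcyclic
    (hT.toSimpleGraph_adj e.2) (SimpleGraph.Reachable.symm h)

theorem head_mem (T : Digraph V) (e : V × V) : e.2 ∈ headSide T e :=
  SimpleGraph.Reachable.refl _

theorem sym2_ne (hT : IsOrientedSpanningTree G T) {e f : Arc T} (h : f ≠ e) :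
    s(f.1.1, f.1.2) ≠ s(e.1.1, e.1.2) := by
  intro he
  obtain ⟨⟨a, b⟩, hab⟩ := e
  obtain ⟨⟨c, d⟩, hcd⟩ := f
  rcases Sym2.eq_iff.1 he with ⟨h1, h2⟩ | ⟨h1, h2⟩
  · exact h (Subtype.ext (Prod.ext h1 h2))
  · simp only at h1 h2 hab hcd
    subst h1 h2
    exact hT.asymm _ _ hab hcd

/-- The edge `f` survives the deletion of `e`, so it joins its ends within one component. This makes
the functionals `coeff` dual to the edge vectors. -/
theorem head_mem_iff_tail_mem (hT : IsOrientedSpanningTree G T) {e f : Arc T} (h : f ≠ e) :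
    f.1.2 ∈ headSide T e.1 ↔ f.1.1 ∈ headSide T e.1 := by
  have hadj : (T.toSimpleGraphInclusive.deleteEdges {s(e.1.1, e.1.2)}).Adj f.1.1 f.1.2 :=
    SimpleGraph.deleteEdges_adj.2 ⟨hT.toSimpleGraph_adj f.2, hT.sym2_ne h⟩
  exact ⟨fun hf => SimpleGraph.Reachable.trans hf hadj.symm.reachable,
    fun hf => SimpleGraph.Reachable.trans hf hadj.reachable⟩

/-- In a tree, the edge `e` points away from `v` if and only if `v` is not on the head side. -/
theorem pointsAwayFrom_iff (hT : IsOrientedSpanningTree G T) (e : Arc T) (v : V) :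
    PointsAwayFrom T v e.1 ↔ v ∉ headSide T e.1 := by
  -- Deleting `e` leaves only the components of its two ends: this is an invariant along any walk.
  have hside : ∀ {u w : V}, T.toSimpleGraphInclusive.Walk u w →
      ((T.toSimpleGraphInclusive.deleteEdges {s(e.1.1, e.1.2)}).Reachable e.1.1 u ∨
        u ∈ headSide T e.1) →
      ((T.toSimpleGraphInclusive.deleteEdges {s(e.1.1, e.1.2)}).Reachable e.1.1 w ∨
        w ∈ headSide T e.1) := by
    intro u w p
    induction p with
    | nil => exact id
    | @cons a b c h p ih =>
      intro ha
      apply ih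
      by_cases hs : s(a, b) = s(e.1.1, e.1.2)
      · rcases Sym2.eq_iff.1 hs with ⟨-, h2⟩ | ⟨-, h2⟩
        · exact Or.inr (h2 ▸ head_mem T e.1)
        · exact Or.inl (h2 ▸ SimpleGraph.Reachable.refl _)
      · have hadj : (T.toSimpleGraphInclusive.deleteEdges {s(e.1.1, e.1.2)}).Adj a b :=
          SimpleGraph.deleteEdges_adj.2 ⟨h, hs⟩
        exact ha.imp (fun h => h.trans hadj.reachable)
          (fun h => SimpleGraph.Reachable.trans h hadj.reachable)
  constructor
  · rintro ⟨-, h⟩ hv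
    exact hT.tail_notMem e (SimpleGraph.Reachable.trans hv h.symm)
  · intro hv
    exact ⟨e.2, (hside (hT.isTree.connected.preconnected e.1.1 v).some
      (Or.inl (SimpleGraph.Reachable.refl _))).resolve_right hv⟩

theorem card_arc [Fintype V] (hT : IsOrientedSpanningTree G T) :
    Fintype.card (Arc T) + 1 = Fintype.card V := by
  classical
  rw [← hT.isTree.card_edgeFinset, ← Finset.card_univ]
  congr 1
  refine Finset.card_bij (fun e _ => s(e.1.1, e.1.2)) (fun e _ => ?_) (fun e _ f _ h => ?_)
    (fun b hb => ?_)
  · simpa using hT.toSimpleGraph_adj e.2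
  · by_contra hne
    exact hT.sym2_ne hne h
  · induction b with
    | h a b =>
      rw [SimpleGraph.mem_edgeFinset, SimpleGraph.mem_edgeSet] at hb
      rcases adj_or_adj hb with h | h
      · exact ⟨⟨(a, b), h⟩, Finset.mem_univ _, rfl⟩
      · exact ⟨⟨(b, a), h⟩, Finset.mem_univ _, Sym2.eq_swap⟩

variable [Fintype V] [DecidableEq V]

open Classical in
theorem coeff_arcVec (hT : IsOrientedSpanningTree G T) (R : Type*) [Ring R] (e f : Arc T) :
    coeff T e.1 (arcVec R f.1) = if f = e then 1 else 0 := by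
  rw [SymEdge.coeff_arcVec]
  by_cases h : f = e
  · subst h
    rw [if_pos (head_mem _ _), if_neg (hT.tail_notMem f), if_pos rfl, sub_zero]
  · simp only [hT.head_mem_iff_tail_mem h, sub_self, h, if_false]

theorem coeff_sum_smul (hT : IsOrientedSpanningTree G T) {R : Type*} [Ring R] (c : Arc T → R)
    (e : Arc T) : coeff T e.1 (∑ f, c f • arcVec R f.1) = c e := by
  classical
  simp [map_sum, hT.coeff_arcVec]

/-- A vector with zero sum is the combination of the edge vectors of the tree with the
coefficients `coeff`. -/
theorem sum_coeff_smul (hT : IsOrientedSpanningTree G T) {R : Type*} [CommRing R] {x : V → R}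
    (hx : ∑ u, x u = 0) : ∑ e : Arc T, coeff T e.1 x • arcVec R e.1 = x := by
  classical
  let F : (V → R) →ₗ[R] (V → R) := ∑ e : Arc T, (coeff T e.1).smulRight (arcVec R e.1)
  have hF (y : V → R) : F y = ∑ e : Arc T, coeff T e.1 y • arcVec R e.1 := by
    simp [F, LinearMap.sum_apply]
  -- Two linear maps are compared on the edge vectors, which span the zero-sum vectors over any
  -- ring.
  have hmem : x ∈ LinearMap.eqLocus F LinearMap.id := by
    have harc (e : Arc T) : F (arcVec R e.1) = arcVec R e.1 := by
      simp [hF, hT.coeff_arcVec]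
    refine mem_of_sum_eq_zero hT.isTree.connected (fun u w h => ?_) hx
    rw [LinearMap.mem_eqLocus, LinearMap.id_apply]
    rcases adj_or_adj h with h | h
    · exact harc ⟨(u, w), h⟩
    · have : arcVec R (u, w) = - arcVec R (w, u) := by simp [arcVec]
      rw [this, map_neg]
      exact congrArg _ (harc ⟨(w, u), h⟩)
  rw [← hF]
  exact hmem

end IsOrientedSpanningTree

/-- The vector `|V| 1_v - ∑ 1_u`, which is generic with respect to all spanning trees. -/
def genericVec {V : Type*} [Fintype V] [DecidableEq V] (v : V) : V → ℝ :=
  (Fintype.card V : ℝ) • Pi.single v 1 - 1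

theorem sum_genericVec {V : Type*} [Fintype V] [DecidableEq V] (v : V) :
    ∑ u, genericVec v u = 0 := by
  simp [genericVec, Finset.sum_sub_distrib, ← Finset.mul_sum]

open Classical in
theorem coeff_genericVec {V : Type*} [Fintype V] [DecidableEq V] (T : Digraph V) (e : V × V)
    (v : V) : coeff T e (genericVec v) =
      (if v ∈ headSide T e then (Fintype.card V : ℝ) else 0) -
        (Finset.univ.filter (· ∈ headSide T e)).card := by
  rw [genericVec, map_sub, map_smul]
  congr 1
  · simp only [coeff, LinearMap.coe_mk, AddHom.coe_mk]
    rw [Finset.sum_eq_single v]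
    · simp
    · intro u _ hu
      simp [hu]
    · simp
  · simp [coeff]

theorem IsOrientedSpanningTree.coeff_genericVec_neg {V : Type*} [Fintype V] [DecidableEq V]
    {G : SimpleGraph V} {T : Digraph V} (hT : IsOrientedSpanningTree G T) {e : Arc T} {v : V}
    (h : PointsAwayFrom T v e.1) : coeff T e.1 (genericVec v) < 0 := by
  classical
  rw [coeff_genericVec, if_neg ((hT.pointsAwayFrom_iff e v).1 h), zero_sub, neg_lt_zero,
    Nat.cast_pos, Finset.card_pos]
  exact ⟨e.1.2, by simpa using head_mem T e.1⟩

theorem IsOrientedSpanningTree.coeff_genericVec_pos {V : Type*} [Fintype V] [DecidableEq V]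
    {G : SimpleGraph V} {T : Digraph V} (hT : IsOrientedSpanningTree G T) {e : Arc T} {v : V}
    (h : ¬ PointsAwayFrom T v e.1) : 0 < coeff T e.1 (genericVec v) := by
  classical
  rw [coeff_genericVec, if_pos (not_not.1 ((hT.pointsAwayFrom_iff e v).not.1 h)), sub_pos,
    Nat.cast_lt, ← Finset.card_univ]
  refine Finset.card_lt_card ⟨Finset.filter_subset _ _, fun hsub => ?_⟩
  exact hT.tail_notMem e (by simpa using hsub (Finset.mem_univ e.1.1))

end

section

/-! ### The symmetric edge polytope in the space of vectors with zero sum -/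

/-- The space of vectors with zero coordinate sum. -/
def zeroSum (V : Type*) [Fintype V] : Submodule ℝ (V → ℝ) :=
  LinearMap.ker (∑ u : V, LinearMap.proj u : (V → ℝ) →ₗ[ℝ] ℝ)

theorem mem_zeroSum {V : Type*} [Fintype V] {x : V → ℝ} : x ∈ zeroSum V ↔ ∑ u, x u = 0 := by
  simp [zeroSum, LinearMap.mem_ker, LinearMap.sum_apply]

theorem finrank_zeroSum (V : Type*) [Fintype V] [Nonempty V] :
    Module.finrank ℝ (zeroSum V) + 1 = Fintype.card V := by
  classical
  have hsurj : Function.Surjective (∑ u : V, LinearMap.proj u : (V → ℝ) →ₗ[ℝ] ℝ) := by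
    intro a
    obtain ⟨v⟩ := ‹Nonempty V›
    exact ⟨Pi.single v a, by simp [LinearMap.sum_apply]⟩
  have h := LinearMap.finrank_range_add_finrank_ker
    (∑ u : V, LinearMap.proj u : (V → ℝ) →ₗ[ℝ] ℝ)
  rw [LinearMap.range_eq_top.2 hsurj, finrank_top, Module.finrank_self,
    Module.finrank_fintype_fun_eq_card] at h
  rw [zeroSum, ← h, add_comm]

/-- A combination with nonnegative weights of total at most one of points of a convex set
containing the origin lies in the set. -/
theorem _root_.Convex.sum_smul_mem_of_zero_mem {E ι : Type*} [AddCommGroup E] [Module ℝ E]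
    [Fintype ι] {s : Set E} (hs : Convex ℝ s) (h0 : (0 : E) ∈ s) {w : ι → ℝ} {y : ι → E}
    (hw : ∀ i, 0 ≤ w i) (hw1 : ∑ i, w i ≤ 1) (hy : ∀ i, y i ∈ s) : ∑ i, w i • y i ∈ s := by
  -- The missing weight is placed on the origin, indexed by `none`.
  have h := hs.sum_mem (t := Finset.univ) (w := fun o : Option ι => o.elim (1 - ∑ i, w i) w)
    (z := fun o => o.elim 0 y) (by rintro (_ | i) - <;> simp [hw, hw1])
    (by simp [Fintype.sum_option]) (by rintro (_ | i) - <;> simp [h0, hy])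
  simpa [Fintype.sum_option] using h

theorem intrinsicFrontier_eq_image {E : Type*} [NormedAddCommGroup E] [NormedSpace ℝ E]
    {s : Set E} {W : Submodule ℝ E} (h : affineSpan ℝ s = W.toAffineSubspace) :
    intrinsicFrontier ℝ s = (↑) '' frontier ((↑) ⁻¹' s : Set W) := by
  -- The span occurs in the ambient type of the frontier, so it is replaced by a variable and
  -- substituted.
  have key {A : AffineSubspace ℝ E} (h : affineSpan ℝ s = A) :
      intrinsicFrontier ℝ s = (↑) '' frontier ((↑) ⁻¹' s : Set A) := by
    subst h
    rfl
  exact key h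

theorem exists_isOrientedSpanningTree {V : Type*} [Finite V] {G : SimpleGraph V}
    (hG : G.Connected) : ∃ T, IsOrientedSpanningTree G T := by
  obtain ⟨S, hSG, hS⟩ := hG.exists_isTree_le
  obtain ⟨n, ⟨f⟩⟩ := Finite.exists_equiv_fin V
  -- Any numbering of the vertices orients each edge exactly once.
  let T : Digraph V := ⟨fun t h => S.Adj t h ∧ f t < f h⟩
  have hT : T.toSimpleGraphInclusive = S := by
    ext a b
    rw [Digraph.toSimpleGraphInclusive, SimpleGraph.fromRel_adj]
    constructor
    · rintro ⟨-, h | h⟩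
      · exact h.1
      · exact h.1.symm
    · intro h
      refine ⟨h.ne, ?_⟩
      rcases lt_or_gt_of_ne (f.injective.ne h.ne) with hlt | hlt
      · exact Or.inl ⟨h, hlt⟩
      · exact Or.inr ⟨h.symm, hlt⟩
  exact ⟨T, fun t h e => hSG e.1, fun t h e e' => lt_asymm e.2 e'.2, hT ▸ hS⟩

theorem continuous_coeff {V : Type*} [Fintype V] (T : Digraph V) (e : V × V) :
    Continuous (coeff (R := ℝ) T e) :=
  LinearMap.continuous_of_finiteDimensional _

variable {V : Type*} [DecidableEq V] {G : SimpleGraph V} {T : Digraph V}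

theorem arcVec_mem_symmetricEdgePolytope {u w : V} (h : G.Adj u w) :
    arcVec ℝ (u, w) ∈ symmetricEdgePolytope G :=
  subset_convexHull ℝ _ ⟨w, u, h.symm, rfl⟩

theorem zero_mem_symmetricEdgePolytope [Nontrivial V] (hG : G.Connected) :
    (0 : V → ℝ) ∈ symmetricEdgePolytope G := by
  obtain ⟨u⟩ := hG.nonempty
  obtain ⟨w, h⟩ := hG.preconnected.exists_adj_of_nontrivial u
  have hm : _ ∈ symmetricEdgePolytope G := (convex_convexHull ℝ _) (arcVec_mem_symmetricEdgePolytope h)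
    (arcVec_mem_symmetricEdgePolytope h.symm) (a := 1 / 2) (b := 1 / 2)
    (by norm_num) (by norm_num) (by norm_num)
  convert hm using 1
  rw [← smul_add]
  simp [arcVec]

variable [Fintype V]

theorem symmetricEdgePolytope_subset : symmetricEdgePolytope G ⊆ zeroSum V := by
  refine convexHull_min ?_ (zeroSum V).convex
  rintro _ ⟨u, w, -, rfl⟩
  exact mem_zeroSum.2 (sum_arcVec (w, u))

theorem vectorSpan_symmetricEdgePolytope [Nontrivial V] (hG : G.Connected) :
    vectorSpan ℝ (symmetricEdgePolytope G) = zeroSum V := by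
  apply le_antisymm
  · rw [vectorSpan_def, Submodule.span_le]
    rintro _ ⟨x, hx, y, hy, rfl⟩
    exact (zeroSum V).sub_mem (symmetricEdgePolytope_subset hx) (symmetricEdgePolytope_subset hy)
  · intro x hx
    refine mem_of_sum_eq_zero hG (fun u w h => ?_) (mem_zeroSum.1 hx)
    simpa using vsub_mem_vectorSpan ℝ (arcVec_mem_symmetricEdgePolytope h)
      (zero_mem_symmetricEdgePolytope hG)

theorem affineSpan_symmetricEdgePolytope [Nontrivial V] (hG : G.Connected) :
    affineSpan ℝ (symmetricEdgePolytope G) = (zeroSum V).toAffineSubspace := by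
  refine AffineSubspace.ext_of_direction_eq ?_
    ⟨0, subset_affineSpan ℝ _ (zero_mem_symmetricEdgePolytope hG), (zeroSum V).zero_mem⟩
  rw [direction_affineSpan, vectorSpan_symmetricEdgePolytope hG,
    Submodule.toAffineSubspace_direction]

/-- The cross-polytope on the signed edge vectors of one tree lies inside the symmetric edge
polytope. -/
theorem IsOrientedSpanningTree.mem_symmetricEdgePolytope [Nontrivial V] (hG : G.Connected)
    (hT : IsOrientedSpanningTree G T) {x : V → ℝ} (hx : x ∈ zeroSum V)
    (h : ∑ e : Arc T, |coeff T e.1 x| ≤ 1) : x ∈ symmetricEdgePolytope G := by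
  rw [← hT.sum_coeff_smul (mem_zeroSum.1 hx)]
  have habs (e : Arc T) : coeff T e.1 x • arcVec ℝ e.1 =
      |coeff T e.1 x| • (if 0 ≤ coeff T e.1 x then arcVec ℝ e.1 else arcVec ℝ e.1.swap) := by
    split_ifs with h
    · rw [abs_of_nonneg h]
    · rw [abs_of_neg (not_le.1 h), arcVec, arcVec, Prod.fst_swap, Prod.snd_swap, neg_smul,
        ← smul_neg, neg_sub]
  simp_rw [habs]
  refine (convex_convexHull ℝ _).sum_smul_mem_of_zero_mem (zero_mem_symmetricEdgePolytope hG)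
    (fun e => abs_nonneg _) h fun e => ?_
  split_ifs
  · exact arcVec_mem_symmetricEdgePolytope (hT.adj_of_adj _ _ e.2)
  · exact arcVec_mem_symmetricEdgePolytope (hT.adj_of_adj _ _ e.2).symm

theorem preimage_symmetricEdgePolytope_mem_nhds [Nontrivial V] (hG : G.Connected) :
    ((↑) ⁻¹' symmetricEdgePolytope G : Set (zeroSum V)) ∈ nhds 0 := by
  obtain ⟨T, hT⟩ := exists_isOrientedSpanningTree hG
  have hc : Continuous fun x : zeroSum V => ∑ e : Arc T, |coeff T e.1 (x : V → ℝ)| :=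
    continuous_finsetSum _ fun e _ => ((continuous_coeff T _).comp continuous_subtype_val).abs
  filter_upwards [hc.continuousAt.eventually_lt_const (show _ < (1 : ℝ) by simp)] with x hx
  exact hT.mem_symmetricEdgePolytope hG x.2 hx.le

theorem gauge_preimage_symmetricEdgePolytope (x : zeroSum V) :
    gauge ((↑) ⁻¹' symmetricEdgePolytope G : Set (zeroSum V)) x =
      gauge (symmetricEdgePolytope G) (x : V → ℝ) := by
  simp [gauge_def']

theorem convex_preimage_symmetricEdgePolytope :
    Convex ℝ ((↑) ⁻¹' symmetricEdgePolytope G : Set (zeroSum V)) :=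
  (convex_convexHull ℝ _).linear_preimage (zeroSum V).subtype

/-- Within its span the polytope is a convex neighbourhood of the origin, so its boundary is the
unit sphere of its gauge. -/
theorem mem_intrinsicFrontier_symmetricEdgePolytope [Nontrivial V] (hG : G.Connected)
    {x : V → ℝ} : x ∈ intrinsicFrontier ℝ (symmetricEdgePolytope G) ↔
      x ∈ zeroSum V ∧ gauge (symmetricEdgePolytope G) x = 1 := by
  have hfr (y : zeroSum V) : y ∈ frontier ((↑) ⁻¹' symmetricEdgePolytope G : Set (zeroSum V)) ↔
      gauge (symmetricEdgePolytope G) (y : V → ℝ) = 1 := by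
    rw [← gauge_preimage_symmetricEdgePolytope, gauge_eq_one_iff_mem_frontier
      convex_preimage_symmetricEdgePolytope (preimage_symmetricEdgePolytope_mem_nhds hG)]
  have hspan := affineSpan_symmetricEdgePolytope hG
  have himage := intrinsicFrontier_eq_image (E := V → ℝ) (s := symmetricEdgePolytope G)
    (W := zeroSum V) hspan
  rw [himage]
  constructor
  · rintro ⟨y, hy, rfl⟩
    exact ⟨y.2, (hfr y).1 hy⟩
  · rintro ⟨hx, h⟩
    exact ⟨⟨x, hx⟩, (hfr ⟨x, hx⟩).2 h, rfl⟩

theorem gauge_symmetricEdgePolytope_pos [Nontrivial V] (hG : G.Connected) {x : V → ℝ}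
    (hx : x ∈ zeroSum V) (h0 : x ≠ 0) : 0 < gauge (symmetricEdgePolytope G) x := by
  rw [← gauge_preimage_symmetricEdgePolytope ⟨x, hx⟩]
  refine (gauge_pos (absorbent_nhds_zero (preimage_symmetricEdgePolytope_mem_nhds hG)) ?_).2
    fun h => h0 (congrArg Subtype.val h)
  rw [NormedSpace.isVonNBounded_iff]
  have hfin : {x : V → ℝ | ∃ u w : V, G.Adj u w ∧ x = Pi.single u 1 - Pi.single w 1}.Finite := by
    refine (Set.finite_range fun e : V × V => (Pi.single e.1 1 - Pi.single e.2 1 : V → ℝ)).subset ?_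
    rintro _ ⟨u, w, -, rfl⟩
    exact ⟨(u, w), rfl⟩
  have hb : Bornology.IsBounded (symmetricEdgePolytope G) := isBounded_convexHull.2 hfin.isBounded
  exact isometry_subtype_coe.antilipschitz.isBounded_preimage hb

/-! ### The simplices of oriented spanning trees -/

namespace IsOrientedSpanningTree

theorem mem_rootPolytope (hT : IsOrientedSpanningTree G T) {x : V → ℝ} :
    x ∈ rootPolytope T ↔
      x ∈ zeroSum V ∧ (∀ e : Arc T, 0 ≤ coeff T e.1 x) ∧ ∑ e : Arc T, coeff T e.1 x = 1 := by
  classical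
  constructor
  · intro hx
    have hconv : Convex ℝ {x : V → ℝ | x ∈ zeroSum V ∧ (∀ e : Arc T, 0 ≤ coeff T e.1 x) ∧
        ∑ e : Arc T, coeff T e.1 x = 1} := by
      rintro x ⟨hx, hx', hx1⟩ y ⟨hy, hy', hy1⟩ a b ha hb hab
      refine ⟨(zeroSum V).add_mem ((zeroSum V).smul_mem _ hx) ((zeroSum V).smul_mem _ hy),
        fun e => ?_, ?_⟩
      · rw [map_add, map_smul, map_smul, smul_eq_mul, smul_eq_mul]
        exact add_nonneg (mul_nonneg ha (hx' e)) (mul_nonneg hb (hy' e))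
      · simp only [map_add, map_smul, smul_eq_mul, Finset.sum_add_distrib, ← Finset.mul_sum, hx1,
          hy1, mul_one, hab]
    refine convexHull_min ?_ hconv hx
    rintro _ ⟨t, h, e, rfl⟩
    refine ⟨mem_zeroSum.2 (sum_arcVec (t, h)), fun f => ?_, ?_⟩
    · have := hT.coeff_arcVec ℝ f ⟨(t, h), e⟩
      rw [arcVec] at this
      rw [this]
      split_ifs <;> norm_num
    · have (f : Arc T) := hT.coeff_arcVec ℝ f ⟨(t, h), e⟩
      simp only [arcVec] at this
      simp [this]
  · rintro ⟨hx, h0, h1⟩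
    rw [← hT.sum_coeff_smul (mem_zeroSum.1 hx)]
    exact (convex_convexHull ℝ _).sum_mem (fun e _ => h0 e) h1
      fun e _ => subset_convexHull ℝ _ ⟨e.1.1, e.1.2, e.2, rfl⟩

theorem mem_intrinsicInterior_rootPolytope (hT : IsOrientedSpanningTree G T) {x : V → ℝ}
    (hx : x ∈ zeroSum V) (h0 : ∀ e : Arc T, 0 < coeff T e.1 x)
    (h1 : ∑ e : Arc T, coeff T e.1 x = 1) : x ∈ intrinsicInterior ℝ (rootPolytope T) := by
  -- The equations hold on the whole affine span, so only the strict inequalities must persist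
  -- nearby, and these are open.
  have hspan {y : V → ℝ} (hy : y ∈ affineSpan ℝ (rootPolytope T)) :
      y ∈ zeroSum V ∧ ∑ e : Arc T, coeff T e.1 y = 1 := by
    refine affineSpan_induction (p := fun y => y ∈ zeroSum V ∧ ∑ e : Arc T, coeff T e.1 y = 1) hy
      (fun y hy => ?_) (fun c u v w hu hv hw => ?_)
    · exact ⟨(hT.mem_rootPolytope.1 hy).1, (hT.mem_rootPolytope.1 hy).2.2⟩
    · refine ⟨(zeroSum V).add_mem ((zeroSum V).smul_mem _ ((zeroSum V).sub_mem hu.1 hv.1)) hw.1, ?_⟩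
      simp only [vsub_eq_sub, vadd_eq_add, map_add, map_smul, map_sub, Finset.sum_add_distrib,
        Finset.sum_sub_distrib, ← Finset.smul_sum, hu.2, hv.2, hw.2]
      simp
  rw [mem_intrinsicInterior]
  refine ⟨⟨x, subset_affineSpan ℝ _ (hT.mem_rootPolytope.2 ⟨hx, fun e => (h0 e).le, h1⟩)⟩,
    mem_interior_iff_mem_nhds.2 ?_, rfl⟩
  have hev : ∀ e : Arc T, ∀ᶠ y : affineSpan ℝ (rootPolytope T) in
      nhds ⟨x, subset_affineSpan ℝ _ (hT.mem_rootPolytope.2 ⟨hx, fun e => (h0 e).le, h1⟩)⟩,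
      0 < coeff T e.1 (y : V → ℝ) := fun e =>
    ((continuous_coeff T e.1).comp continuous_subtype_val).continuousAt.eventually_const_lt (h0 e)
  filter_upwards [Filter.eventually_all.2 hev] with y hy
  exact hT.mem_rootPolytope.2 ⟨(hspan y.2).1, fun e => (hy e).le, (hspan y.2).2⟩

theorem eq_zero_of_sum_coeff_eq_zero (hT : IsOrientedSpanningTree G T) {x : V → ℝ}
    (hx : x ∈ zeroSum V) (h0 : ∀ e : Arc T, 0 ≤ coeff T e.1 x)
    (h : ∑ e : Arc T, coeff T e.1 x = 0) : x = 0 := by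
  rw [← hT.sum_coeff_smul (mem_zeroSum.1 hx)]
  rw [Finset.sum_eq_zero_iff_of_nonneg fun e _ => h0 e] at h
  exact Finset.sum_eq_zero fun e he => by rw [h e he, zero_smul]

/-- If the simplex of `T` lies in the boundary of the symmetric edge polytope, then the gauge of
the polytope is linear on the cone of `T`. -/
theorem gauge_eq_sum_coeff [Nontrivial V] (hG : G.Connected) (hT : IsOrientedSpanningTree G T)
    (hsub : rootPolytope T ⊆ intrinsicFrontier ℝ (symmetricEdgePolytope G)) {x : V → ℝ}
    (hx : x ∈ zeroSum V) (h0 : ∀ e : Arc T, 0 ≤ coeff T e.1 x) :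
    gauge (symmetricEdgePolytope G) x = ∑ e : Arc T, coeff T e.1 x := by
  rcases (Finset.sum_nonneg fun e _ => h0 e).eq_or_lt with hs | hs
  · rw [← hs, hT.eq_zero_of_sum_coeff_eq_zero hx h0 hs.symm, gauge_zero]
  · have hy : (∑ e : Arc T, coeff T e.1 x)⁻¹ • x ∈ rootPolytope T := by
      refine hT.mem_rootPolytope.2 ⟨(zeroSum V).smul_mem _ hx, fun e => ?_, ?_⟩
      · rw [map_smul]
        exact mul_nonneg (inv_nonneg.2 hs.le) (h0 e)
      · simp only [map_smul, smul_eq_mul, ← Finset.mul_sum]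
        exact inv_mul_cancel₀ hs.ne'
    have h1 := ((mem_intrinsicFrontier_symmetricEdgePolytope hG).1 (hsub hy)).2
    rw [gauge_smul_of_nonneg (inv_nonneg.2 hs.le), smul_eq_mul] at h1
    field_simp at h1
    exact h1

theorem mem_smul_iff_sum_coeff_le [Nontrivial V] (hG : G.Connected)
    (hT : IsOrientedSpanningTree G T)
    (hsub : rootPolytope T ⊆ intrinsicFrontier ℝ (symmetricEdgePolytope G)) {x : V → ℝ}
    (hx : x ∈ zeroSum V) (h0 : ∀ e : Arc T, 0 ≤ coeff T e.1 x) {t : ℝ} (ht : 0 ≤ t) :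
    x ∈ t • symmetricEdgePolytope G ↔ ∑ e : Arc T, coeff T e.1 x ≤ t := by
  constructor
  · intro h
    rw [← hT.gauge_eq_sum_coeff hG hsub hx h0]
    exact gauge_le_of_mem ht h
  · intro h
    -- The case `t = 0` is separate, since rescaling by the inverse of `t` is then impossible.
    rcases ht.eq_or_lt with rfl | ht
    · rw [hT.eq_zero_of_sum_coeff_eq_zero hx h0 (h.antisymm (Finset.sum_nonneg fun e _ => h0 e))]
      exact ⟨0, zero_mem_symmetricEdgePolytope hG, smul_zero _⟩
    · rw [Set.mem_smul_set_iff_inv_smul_mem₀ ht.ne']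
      refine hT.mem_symmetricEdgePolytope hG ((zeroSum V).smul_mem _ hx) ?_
      simp only [map_smul, smul_eq_mul, abs_mul, abs_of_nonneg (h0 _), ← Finset.mul_sum,
        abs_of_pos (inv_pos.2 ht)]
      rw [inv_mul_le_iff₀ ht]
      simpa using h

end IsOrientedSpanningTree

/-! ### The cones over a dissection -/

namespace IsDissectingTreeSet

variable {𝒯 : Set (Digraph V)}

theorem rootPolytope_subset (h : IsDissectingTreeSet G 𝒯) (hT : T ∈ 𝒯) :
    rootPolytope T ⊆ intrinsicFrontier ℝ (symmetricEdgePolytope G) := by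
  rw [← h.cover]
  exact Set.subset_biUnion_of_mem (u := fun T => rootPolytope T) hT

/-- The cones over the simplices of a dissection cover the space. -/
theorem exists_forall_coeff_nonneg [Nontrivial V] (hG : G.Connected)
    (h : IsDissectingTreeSet G 𝒯) {x : V → ℝ} (hx : x ∈ zeroSum V) (hx0 : x ≠ 0) :
    ∃ T ∈ 𝒯, ∀ e : Arc T, 0 ≤ coeff T e.1 x := by
  have hpos := gauge_symmetricEdgePolytope_pos hG hx hx0
  have hmem : (gauge (symmetricEdgePolytope G) x)⁻¹ • x ∈
      intrinsicFrontier ℝ (symmetricEdgePolytope G) := by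
    refine (mem_intrinsicFrontier_symmetricEdgePolytope hG).2 ⟨(zeroSum V).smul_mem _ hx, ?_⟩
    rw [gauge_smul_of_nonneg (inv_nonneg.2 hpos.le), smul_eq_mul, inv_mul_cancel₀ hpos.ne']
  rw [← h.cover, Set.mem_iUnion₂] at hmem
  obtain ⟨T, hT, hm⟩ := hmem
  refine ⟨T, hT, fun e => ?_⟩
  have := ((h.isOrientedSpanningTree T hT).mem_rootPolytope.1 hm).2.1 e
  rw [map_smul, smul_eq_mul] at this
  exact nonneg_of_mul_nonneg_right this (inv_pos.2 hpos)

/-- The open cones over the simplices of a dissection are disjoint. -/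
theorem eq_of_forall_coeff_pos [Nontrivial V] (hG : G.Connected) (h : IsDissectingTreeSet G 𝒯)
    {x : V → ℝ} (hx : x ∈ zeroSum V) (hx0 : x ≠ 0) {T T' : Digraph V} (hT : T ∈ 𝒯) (hT' : T' ∈ 𝒯)
    (hpos : ∀ e : Arc T, 0 < coeff T e.1 x) (hpos' : ∀ e : Arc T', 0 < coeff T' e.1 x) :
    T = T' := by
  by_contra hne
  have hg := gauge_symmetricEdgePolytope_pos hG hx hx0
  -- The rescaling factor is the gauge of `x`, independent of the tree, so both simplices would
  -- contain the same interior point.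
  have key {S : Digraph V} (hS : S ∈ 𝒯) (hp : ∀ e : Arc S, 0 < coeff S e.1 x) :
      (gauge (symmetricEdgePolytope G) x)⁻¹ • x ∈ intrinsicInterior ℝ (rootPolytope S) := by
    refine (h.isOrientedSpanningTree S hS).mem_intrinsicInterior_rootPolytope
      ((zeroSum V).smul_mem _ hx) (fun e => ?_) ?_
    · rw [map_smul]
      exact mul_pos (inv_pos.2 hg) (hp e)
    · simp only [map_smul, smul_eq_mul, ← Finset.mul_sum]
      rw [← (h.isOrientedSpanningTree S hS).gauge_eq_sum_coeff hG (h.rootPolytope_subset hS) hx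
        fun e => (hp e).le]
      exact inv_mul_cancel₀ hg.ne'
  exact Set.disjoint_left.1 (h.interior_disjoint T hT T' hT' hne) (key hT hpos) (key hT' hpos')

end IsDissectingTreeSet

end

section

/-! ### Counting -/

/-- A slack variable at `none` turns the inequality into an equality, counted by stars and bars. -/
theorem ncard_setOf_sum_le (A : Type*) [Fintype A] (m : ℕ) :
    {f : A → ℕ | ∑ a, f a ≤ m}.ncard = (m + Fintype.card A).choose (Fintype.card A) := by
  classical
  have himage : {f : A → ℕ | ∑ a, f a ≤ m} = (fun (g : Option A →₀ ℕ) a => g (some a)) ''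
      (Finset.finsuppAntidiag (Finset.univ : Finset (Option A)) m : Set (Option A →₀ ℕ)) := by
    ext f
    simp only [Set.mem_ofPred_eq, Set.mem_image, Finset.mem_coe, Finset.mem_finsuppAntidiag,
      Fintype.sum_option]
    constructor
    · intro h
      refine ⟨Finsupp.equivFunOnFinite.symm fun o => o.elim (m - ∑ a, f a) f, ⟨?_, ?_⟩, ?_⟩
      · simp only [Finsupp.coe_equivFunOnFinite_symm, Option.elim]
        omega
      · exact Finset.subset_univ _
      · simp
    · rintro ⟨g, ⟨hg, -⟩, rfl⟩
      exact (Nat.le_add_left _ _).trans_eq hg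
  rw [himage, Set.InjOn.ncard_image, Set.ncard_coe_finset,
    Finset.card_finsuppAntidiag_nat_eq_choose, Finset.card_univ, Fintype.card_option]
  · rw [add_right_comm, Nat.add_sub_cancel, add_comm m]
    exact (Nat.choose_symm_add (a := Fintype.card A) (b := m)).symm
  · intro g hg g' hg' h
    have hsum {g : Option A →₀ ℕ} (hg : g ∈ (Finset.finsuppAntidiag Finset.univ m)) :
        g none + ∑ a, g (some a) = m := by
      rw [← Fintype.sum_option, (Finset.mem_finsuppAntidiag.1 hg).1]
    have h' (a : A) : g (some a) = g' (some a) := congrFun h a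
    have h1 := hsum hg
    have h2 := hsum hg'
    simp_rw [h'] at h1
    ext o
    cases o with
    | none => omega
    | some a => exact h' a

theorem finite_setOf_nonneg_sum_le {A : Type*} [Fintype A] (p : A → Prop) (t : ℕ) :
    {c : A → ℤ | (∀ a, 0 ≤ c a ∧ (p a → 0 < c a)) ∧ ∑ a, c a ≤ t}.Finite := by
  classical
  refine (Set.finite_Icc (0 : A → ℤ) (fun _ => (t : ℤ))).subset ?_
  rintro c ⟨h0, h1⟩
  exact ⟨fun a => (h0 a).1, fun a =>
    (Finset.single_le_sum (fun b _ => (h0 b).1) (Finset.mem_univ a)).trans h1⟩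

/-- The number of lattice points of the `t`-th dilate of a half-open unimodular simplex. -/
theorem ncard_setOf_nonneg_sum_le {A : Type*} [Fintype A] (p : A → Prop) (t : ℕ) :
    {c : A → ℤ | (∀ a, 0 ≤ c a ∧ (p a → 0 < c a)) ∧ ∑ a, c a ≤ t}.ncard =
      (t + Fintype.card A - {a | p a}.ncard).choose (Fintype.card A) := by
  classical
  have hsum : ∑ a, (if p a then (1 : ℤ) else 0) = {a | p a}.ncard := by
    rw [Finset.sum_boole, Set.ncard_eq_toFinset_card', Set.toFinset_ofPred]
  have hle : {a | p a}.ncard ≤ Fintype.card A := by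
    rw [← Nat.card_eq_fintype_card]
    exact Set.ncard_le_card _
  rcases le_or_gt {a | p a}.ncard t with hi | hi
  · have himage : {c : A → ℤ | (∀ a, 0 ≤ c a ∧ (p a → 0 < c a)) ∧ ∑ a, c a ≤ t} =
        (fun (f : A → ℕ) a => (f a : ℤ) + if p a then 1 else 0) ''
          {f : A → ℕ | ∑ a, f a ≤ t - {a | p a}.ncard} := by
      ext c
      constructor
      · rintro ⟨h0, h1⟩
        have hnn (a : A) : 0 ≤ c a - if p a then 1 else 0 := by
          have := h0 a
          split_ifs with h
          · have := this.2 h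
            omega
          · omega
        refine ⟨fun a => (c a - if p a then 1 else 0).toNat, ?_, ?_⟩
        · rw [Set.mem_ofPred_eq]
          zify [hi]
          rw [Finset.sum_congr rfl fun a _ => Int.toNat_of_nonneg (hnn a), Finset.sum_sub_distrib,
            hsum]
          omega
        · funext a
          simp [Int.toNat_of_nonneg (hnn a)]
      · rintro ⟨f, hf, rfl⟩
        refine ⟨fun a => ?_, ?_⟩
        · dsimp only
          split_ifs with h
          · exact ⟨by positivity, fun _ => by positivity⟩
          · exact ⟨by positivity, fun h' => absurd h' h⟩
        · rw [Finset.sum_add_distrib, hsum]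
          rw [Set.mem_ofPred_eq] at hf
          zify [hi] at hf
          omega
    rw [himage, Set.ncard_image_of_injective, ncard_setOf_sum_le]
    · congr 1
      omega
    · intro f g h
      funext a
      have := congrFun h a
      simpa using this
  -- Here the strict coordinates alone already exceed `t`: the set is empty and the binomial
  -- vanishes.
  · rw [Nat.choose_eq_zero_of_lt (by omega), Set.ncard_eq_zero (finite_setOf_nonneg_sum_le p t),
      Set.eq_empty_iff_forall_notMem]
    rintro c ⟨h0, h1⟩
    have : ∑ a, (if p a then (1 : ℤ) else 0) ≤ ∑ a, c a := by
      refine Finset.sum_le_sum fun a _ => ?_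
      have := h0 a
      split_ifs with h
      · exact this.2 h
      · exact this.1
    rw [hsum] at this
    omega

/-! ### Half-open cones -/

/-- The half-open cone of `T`: the facets opposite to the edges pointing away from `v` are
removed. -/
def halfOpenCone {V : Type*} [Fintype V] (T : Digraph V) (v : V) : Set (V → ℝ) :=
  {x | ∀ e : Arc T, 0 ≤ coeff T e.1 x ∧ (PointsAwayFrom T v e.1 → 0 < coeff T e.1 x)}

/-- For small positive `ε` the sign is that of `a`, with ties broken by `b`. -/
theorem eventually_add_mul_pos_iff (a : ℝ) {b : ℝ} (hb : b ≠ 0) :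
    ∀ᶠ ε in nhdsWithin (0 : ℝ) (Set.Ioi 0),
      a + ε * b ≠ 0 ∧ (0 < a + ε * b ↔ 0 ≤ a ∧ (b < 0 → 0 < a)) := by
  have hc : ContinuousAt (fun ε : ℝ => a + ε * b) 0 := by fun_prop
  rcases lt_trichotomy a 0 with ha | rfl | ha
  · have h := hc.eventually_lt_const (u := 0) (by simpa using ha)
    filter_upwards [h.filter_mono nhdsWithin_le_nhds] with ε hε
    exact ⟨hε.ne, iff_of_false hε.not_gt fun h => ha.not_ge h.1⟩
  · filter_upwards [self_mem_nhdsWithin] with ε hε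
    have hε : 0 < ε := hε
    refine ⟨by simp [hε.ne', hb], ?_⟩
    rcases hb.lt_or_gt with hb | hb
    · simp [hb, (mul_neg_of_pos_of_neg hε hb).not_gt]
    · simp [hb.not_gt, mul_pos hε hb]
  · have h := hc.eventually_const_lt (u := 0) (by simpa using ha)
    filter_upwards [h.filter_mono nhdsWithin_le_nhds] with ε hε
    exact ⟨hε.ne', iff_of_true hε ⟨ha.le, fun _ => ha⟩⟩

theorem numPointingAway_eq {V : Type*} (T : Digraph V) (v : V) :
    numPointingAway T v = {e : Arc T | PointsAwayFrom T v e.1}.ncard := by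
  rw [numPointingAway, ← Set.ncard_image_of_injective _ Subtype.val_injective]
  congr 1
  ext e
  constructor
  · intro h
    exact ⟨⟨e, h.1⟩, h, rfl⟩
  · rintro ⟨f, hf, rfl⟩
    exact hf

variable {V : Type*} [Fintype V] [DecidableEq V]

theorem IsOrientedSpanningTree.eventually_forall_coeff_pos_iff {G : SimpleGraph V} {T : Digraph V}
    (hT : IsOrientedSpanningTree G T) (v : V) (x : V → ℝ) :
    ∀ᶠ ε in nhdsWithin (0 : ℝ) (Set.Ioi 0),
      (∀ e : Arc T, coeff T e.1 (x + ε • genericVec v) ≠ 0) ∧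
        ((∀ e : Arc T, 0 < coeff T e.1 (x + ε • genericVec v)) ↔ x ∈ halfOpenCone T v) := by
  have hne (e : Arc T) : coeff T e.1 (genericVec v) ≠ 0 := by
    by_cases h : PointsAwayFrom T v e.1
    · exact (hT.coeff_genericVec_neg h).ne
    · exact (hT.coeff_genericVec_pos h).ne'
  have haway (e : Arc T) : coeff T e.1 (genericVec v) < 0 ↔ PointsAwayFrom T v e.1 :=
    ⟨fun h => by_contra fun h' => (hT.coeff_genericVec_pos h').not_gt h, hT.coeff_genericVec_neg⟩
  filter_upwards [Filter.eventually_all.2 fun e : Arc T =>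
    eventually_add_mul_pos_iff (coeff T e.1 x) (hne e)] with ε hε
  simp only [map_add, map_smul, smul_eq_mul]
  exact ⟨fun e => (hε e).1, forall_congr' fun e => by rw [(hε e).2, haway]⟩

/-- The half-open cones of a dissection partition the space. -/
theorem IsDissectingTreeSet.existsUnique_mem_halfOpenCone [Nontrivial V] {G : SimpleGraph V}
    (hG : G.Connected) {𝒯 : Set (Digraph V)} (h : IsDissectingTreeSet G 𝒯) (v : V) {x : V → ℝ}
    (hx : x ∈ zeroSum V) : ∃! T, T ∈ 𝒯 ∧ x ∈ halfOpenCone T v := by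
  have hv : genericVec v v ≠ 0 := by
    have : (1 : ℝ) < Fintype.card V := by exact_mod_cast Fintype.one_lt_card
    simp only [genericVec, Pi.sub_apply, Pi.smul_apply, Pi.single_eq_same, smul_eq_mul, mul_one,
      Pi.one_apply]
    linarith
  have hfin : Finite 𝒯 := by
    have : Finite (Digraph V) := Finite.of_injective (fun T : Digraph V => T.Adj)
      fun _ _ h => Digraph.ext h
    infer_instance
  -- Finiteness of `𝒯` allows one `ε` for all trees; the condition at `v` keeps the shifted vector
  -- nonzero.
  obtain ⟨ε, hε, hεv⟩ := ((Filter.eventually_all.2 fun T : 𝒯 =>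
    (h.isOrientedSpanningTree T.1 T.2).eventually_forall_coeff_pos_iff v x).and
      (eventually_add_mul_pos_iff (x v) hv)).exists
  have hy : x + ε • genericVec v ∈ zeroSum V :=
    (zeroSum V).add_mem hx ((zeroSum V).smul_mem _ (mem_zeroSum.2 (sum_genericVec v)))
  have hy0 : x + ε • genericVec v ≠ 0 := fun h0 => hεv.1 (congrFun h0 v)
  obtain ⟨T, hT, hpos⟩ := h.exists_forall_coeff_nonneg hG hy hy0
  -- Covering only gives the closed cone; genericity upgrades it to the open one.
  have hpos' (e : Arc T) := (hpos e).lt_of_ne' ((hε ⟨T, hT⟩).1 e)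
  refine ⟨T, ⟨hT, (hε ⟨T, hT⟩).2.1 hpos'⟩, ?_⟩
  rintro T' ⟨hT', hmem⟩
  exact h.eq_of_forall_coeff_pos hG hy hy0 hT' hT ((hε ⟨T', hT'⟩).2.2 hmem) hpos'

/-! ### Lattice points -/

/-- The lattice points of the half-open cone of `T` in the `t`-th dilate. -/
def latticePoints (T : Digraph V) (v : V) (t : ℕ) : Set (V → ℤ) :=
  {z | ∑ u, z u = 0 ∧ (fun u => (z u : ℝ)) ∈ halfOpenCone T v ∧ ∑ e : Arc T, coeff T e.1 z ≤ t}

namespace IsOrientedSpanningTree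

variable {G : SimpleGraph V} {T : Digraph V}

/-- This is unimodularity: coefficients of an integer vector are integers. -/
theorem latticePoints_eq_image (hT : IsOrientedSpanningTree G T) (v : V) (t : ℕ) :
    latticePoints T v t = (fun c : Arc T → ℤ => ∑ e, c e • arcVec ℤ e.1) ''
      {c | (∀ e, 0 ≤ c e ∧ (PointsAwayFrom T v e.1 → 0 < c e)) ∧ ∑ e, c e ≤ t} := by
  ext z
  constructor
  · rintro ⟨h0, h1, h2⟩
    refine ⟨fun e => coeff T e.1 z, ⟨fun e => ?_, h2⟩, hT.sum_coeff_smul h0⟩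
    have := h1 e
    rw [coeff_intCast] at this
    exact_mod_cast this
  · rintro ⟨c, ⟨h0, h1⟩, rfl⟩
    refine ⟨?_, fun e => ?_, ?_⟩
    · simp only [Finset.sum_apply, Pi.smul_apply, smul_eq_mul]
      rw [Finset.sum_comm]
      exact Finset.sum_eq_zero fun e _ => by rw [← Finset.mul_sum, sum_arcVec, mul_zero]
    · rw [coeff_intCast, hT.coeff_sum_smul]
      exact_mod_cast h0 e
    · simpa only [hT.coeff_sum_smul] using h1

theorem finite_latticePoints (hT : IsOrientedSpanningTree G T) (v : V) (t : ℕ) :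
    (latticePoints T v t).Finite := by
  rw [hT.latticePoints_eq_image]
  exact (finite_setOf_nonneg_sum_le _ _).image _

theorem ncard_latticePoints (hT : IsOrientedSpanningTree G T) (v : V) (t : ℕ) :
    (latticePoints T v t).ncard =
      (t + Fintype.card (Arc T) - numPointingAway T v).choose (Fintype.card (Arc T)) := by
  rw [hT.latticePoints_eq_image, Set.ncard_image_of_injective, ncard_setOf_nonneg_sum_le,
    numPointingAway_eq]
  intro c c' h
  funext e
  rw [← hT.coeff_sum_smul c e, ← hT.coeff_sum_smul c' e]
  exact congrArg _ h

theorem polytopeDim_eq [Nontrivial V] (hG : G.Connected) (hT : IsOrientedSpanningTree G T) :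
    polytopeDim (symmetricEdgePolytope G) = Fintype.card (Arc T) := by
  have h1 := hT.card_arc
  have h2 := finrank_zeroSum V
  rw [polytopeDim, vectorSpan_symmetricEdgePolytope hG]
  omega

theorem numPointingAway_le [Nontrivial V] (hG : G.Connected) (hT : IsOrientedSpanningTree G T)
    (v : V) : numPointingAway T v ≤ polytopeDim (symmetricEdgePolytope G) := by
  rw [hT.polytopeDim_eq hG, numPointingAway_eq, ← Nat.card_eq_fintype_card]
  exact Set.ncard_le_card _

end IsOrientedSpanningTree

/-! ### From the partition to the `h^*`-vector -/

namespace IsDissectingTreeSet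

variable {G : SimpleGraph V} {𝒯 : Set (Digraph V)}

theorem setOf_mem_smul_eq_iUnion [Nontrivial V] (hG : G.Connected) (h : IsDissectingTreeSet G 𝒯)
    (v : V) (t : ℕ) :
    {z : V → ℤ | (fun w => (z w : ℝ)) ∈ (t : ℝ) • symmetricEdgePolytope G} =
      ⋃ T ∈ 𝒯, latticePoints T v t := by
  have hsum (z : V → ℤ) : (fun w => (z w : ℝ)) ∈ zeroSum V ↔ ∑ u, z u = 0 := by
    rw [mem_zeroSum]
    exact_mod_cast Iff.rfl
  have hcoeff {T : Digraph V} (hT : T ∈ 𝒯) {z : V → ℤ} (hz : (fun w => (z w : ℝ)) ∈ zeroSum V)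
      (hmem : (fun w => (z w : ℝ)) ∈ halfOpenCone T v) :
      (fun w => (z w : ℝ)) ∈ (t : ℝ) • symmetricEdgePolytope G ↔
        ∑ e : Arc T, coeff T e.1 z ≤ t := by
    rw [(h.isOrientedSpanningTree T hT).mem_smul_iff_sum_coeff_le hG (h.rootPolytope_subset hT) hz
      (fun e => (hmem e).1) t.cast_nonneg]
    simp_rw [coeff_intCast]
    exact_mod_cast Iff.rfl
  ext z
  simp only [Set.mem_ofPred_eq, Set.mem_iUnion₂]
  constructor
  · intro hz
    have hz0 : (fun w => (z w : ℝ)) ∈ zeroSum V := by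
      obtain ⟨y, hy, hyz⟩ := hz
      rw [← hyz]
      exact (zeroSum V).smul_mem _ (symmetricEdgePolytope_subset hy)
    obtain ⟨T, ⟨hT, hmem⟩, -⟩ := h.existsUnique_mem_halfOpenCone hG v hz0
    exact ⟨T, hT, (hsum z).1 hz0, hmem, (hcoeff hT hz0 hmem).1 hz⟩
  · rintro ⟨T, hT, h0, hmem, hle⟩
    exact (hcoeff hT ((hsum z).2 h0) hmem).2 hle

theorem isHStarVector [Nontrivial V] (hG : G.Connected) (h : IsDissectingTreeSet G 𝒯) (v : V) :
    IsHStarVector (symmetricEdgePolytope G)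
      fun i => ({T ∈ 𝒯 | numPointingAway T v = i}.ncard : ℚ) := by
  classical
  have : Finite (Digraph V) := Finite.of_injective (fun T : Digraph V => T.Adj)
    fun _ _ h => Digraph.ext h
  obtain ⟨S, rfl⟩ : ∃ S : Finset (Digraph V), (S : Set (Digraph V)) = 𝒯 :=
    ⟨(Set.toFinite 𝒯).toFinset, by simp⟩
  have hcard (i : ℕ) : {T ∈ (S : Set (Digraph V)) | numPointingAway T v = i}.ncard =
      (S.filter fun T => numPointingAway T v = i).card := by
    rw [← Set.ncard_coe_finset]
    simp
  constructor
  · intro t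
    have hdisj : (S : Set (Digraph V)).PairwiseDisjoint fun T => latticePoints T v t := by
      intro T hT T' hT' hne
      refine Set.disjoint_left.2 fun z hz hz' => hne ?_
      have hz0 : (fun w => (z w : ℝ)) ∈ zeroSum V := mem_zeroSum.2 (by exact_mod_cast hz.1)
      exact (h.existsUnique_mem_halfOpenCone hG v hz0).unique ⟨hT, hz.2.1⟩ ⟨hT', hz'.2.1⟩
    have hcount : ehrhart (symmetricEdgePolytope G) t = ∑ T ∈ S,
        (t + polytopeDim (symmetricEdgePolytope G) - numPointingAway T v).choose
          (polytopeDim (symmetricEdgePolytope G)) := by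
      rw [ehrhart, h.setOf_mem_smul_eq_iUnion hG v t, S.finite_toSet.ncard_biUnion
        (fun T hT => (h.isOrientedSpanningTree T hT).finite_latticePoints v t) hdisj,
        finsum_mem_coe_finset]
      refine Finset.sum_congr rfl fun T hT => ?_
      rw [(h.isOrientedSpanningTree T hT).ncard_latticePoints,
        (h.isOrientedSpanningTree T hT).polytopeDim_eq hG]
    -- Trees are grouped by their number of edges pointing away from `v`, which is at most the
    -- dimension.
    rw [hcount, ← Finset.sum_fiberwise_of_maps_to
      (t := Finset.range (polytopeDim (symmetricEdgePolytope G) + 1))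
      (g := fun T => numPointingAway T v) fun T hT => Finset.mem_range_succ_iff.2
        ((h.isOrientedSpanningTree T hT).numPointingAway_le hG v), Nat.cast_sum]
    refine Finset.sum_congr rfl fun k _ => ?_
    dsimp only
    rw [hcard, Finset.sum_congr rfl fun T hT => by rw [(Finset.mem_filter.1 hT).2],
      Finset.sum_const, smul_eq_mul, Nat.cast_mul]
  · intro k hk
    dsimp only
    rw [hcard, Finset.filter_eq_empty_iff.2 fun T hT hi => ?_, Finset.card_empty, Nat.cast_zero]
    have := (h.isOrientedSpanningTree T hT).numPointingAway_le hG v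
    omega

end IsDissectingTreeSet

theorem IsHStarVector.hStarVector_eq {V : Type*} {P : Set (V → ℝ)} {a : ℕ → ℚ}
    (ha : IsHStarVector P a) : hStarVector P = a := by
  have h : ∃ a : ℕ → ℚ, IsHStarVector P a := ⟨a, ha⟩
  rw [hStarVector, dif_pos h]
  exact h.choose_spec.unique ha

end

end SymEdge

end

theorem theorem1 {V : Type*} [Fintype V] [DecidableEq V] [Nontrivial V]
    (G : SimpleGraph V) (hG : G.Connected)
    (𝒯 : Set (Digraph V)) (h𝒯 : SymEdge.IsDissectingTreeSet G 𝒯) (v : V) :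
    SymEdge.IsHStarVector (SymEdge.symmetricEdgePolytope G)
        (SymEdge.hStarVector (SymEdge.symmetricEdgePolytope G)) ∧
      ∀ i : ℕ, SymEdge.hStarVector (SymEdge.symmetricEdgePolytope G) i =
        ({T ∈ 𝒯 | SymEdge.numPointingAway T v = i}.ncard : ℚ) := by
  have h := h𝒯.isHStarVector hG v
  rw [h.hStarVector_eq]
  exact ⟨h, fun _ => rfl⟩
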